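/- Let $G=(V,E)$ be a finite simple connected graph and let $\tau$ be a subtree of $G$ (a nonempty connected acyclic subgraph) that is not spanning. Consider Wilson's algorithm on $G$ with initial condition $\tau$: set $V_X=V(\tau)$ and $E_X=E(\tau)$; while $V_X\neq V$, choose $v\in V\setminus V_X$ uniformly at random, run a simple random walk on $G$ from $v$ until it first visits a vertex of $V_X$, let $p_v$ be its loop erasure (loops are erased in chronological order, as they are created), and replace $V_X$ by $V_X\cup V(p_v)$ and $E_X$ by $E_X\cup E(p_v)$; when $V_X=V$, return $T=(V_X,E_X)$. Then the algorithm terminates with probability one, and its output $T$ is uniformly distributed on the set $\mathcal T_G(\tau)$ of the spanning trees of $G$ that contain $\tau$: each $t\in\mathcal T_G(\tau)$ is returned with probability $1/|\mathcal T_G(\tau)|$, and no other subgraph of $G$ is returned with positive probability. -/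

import Mathlib

open scoped ENNReal

namespace Wilson

universe u

variable {V : Type u}

/-- The configurations of Wilson's algorithm on the graph `G`. The current tree `(V_X, E_X)` is the
subgraph `H`.
* `loop H`: the algorithm is at the head of the while loop.
* `walking H w`: a random walk started at the vertex `v` is now at `x`, and `w` is its trajectory so
  far, listed backwards from the current position `x` to the starting vertex `v`.
* `returned H`: the algorithm has stopped and has returned `H`. -/
inductive State (G : SimpleGraph V) : Type u
  | loop (H : G.Subgraph) : State G
  | walking (H : G.Subgraph) {x v : V} (w : G.Walk x v) : State G
  | returned (H : G.Subgraph) : State G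

/-- The path obtained from a random walk by erasing its loops in chronological order, as they are
created. Here the trajectory `w` is listed backwards (current position first) and so is the
resulting path: when the walk makes one more step, to `y`, the new trajectory is `cons _ w`, and
`bypass` either prepends `y` to the loop erasure of `w`, or, if `y` already lies on that path, cuts
off everything that was visited on it after `y`. -/
noncomputable def loopErasure {G : SimpleGraph V} {x v : V} (w : G.Walk x v) : G.Walk x v :=
  letI := Classical.decEq V
  w.bypass

open Classical in
/-- One (random) step of Wilson's algorithm.
* At the head of the loop, if `V_X = V` then the current tree is returned; otherwise a vertex
  `v ∉ V_X` is chosen uniformly at random and a random walk is started at `v`.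
* While walking: if the walk is in `V_X` it stops, and its loop erasure is added to the
  current tree; otherwise it moves to a uniformly chosen neighbour of its current position.
  (A walk at a vertex without neighbours would stay there.) -/
noncomputable def step [Fintype V] (G : SimpleGraph V) : State G → PMF (State G)
  | .loop H =>
      if _h : Nonempty {v : V // v ∉ H.verts} then
        (PMF.uniformOfFintype {v : V // v ∉ H.verts}).map
          fun v => .walking H (SimpleGraph.Walk.nil : G.Walk v.1 v.1)
      else PMF.pure (.returned H)
  | .walking (x := x) H w =>
      if x ∈ H.verts then PMF.pure (.loop (H ⊔ (loopErasure w).toSubgraph))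
      else if _h : Nonempty (G.neighborSet x) then
        (PMF.uniformOfFintype (G.neighborSet x)).map
          fun y => .walking H (SimpleGraph.Walk.cons (SimpleGraph.Adj.symm y.2) w)
      else PMF.pure (.walking H w)
  | .returned H => PMF.pure (.returned H)

/-- The law of the configuration of Wilson's algorithm with initial condition `τ` after `n`
steps. -/
noncomputable def law [Fintype V] (G : SimpleGraph V) (τ : G.Subgraph) : ℕ → PMF (State G)
  | 0 => PMF.pure (.loop τ)
  | n + 1 => (law G τ n).bind (step G)

/-- The probability that Wilson's algorithm with initial condition `τ` stops after finitely many
steps and returns `T`. The events "`T` has been returned by time `n`" increase with `n`, so the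
probability of their union is the supremum. -/
noncomputable def returnProb [Fintype V] (G : SimpleGraph V) (τ T : G.Subgraph) : ℝ≥0∞ :=
  ⨆ n : ℕ, law G τ n (.returned T)

/-- A subgraph that is a tree (nonempty, connected and acyclic). -/
def IsSubtree {G : SimpleGraph V} (T : G.Subgraph) : Prop :=
  T.coe.IsTree

/-- The set of spanning trees of `G` that contain the subgraph `τ`. -/
def spanningTreesContaining (G : SimpleGraph V) (τ : G.Subgraph) : Set G.Subgraph :=
  {T | T.IsSpanning ∧ IsSubtree T ∧ τ ≤ T}

end Wilson

open scoped ENNReal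

namespace Wilson

universe u

variable {V : Type u}

/-! ### Dirichlet Laplacians, their determinants and Green functions. -/

section Green

open Classical Matrix

variable [Fintype V] (G : SimpleGraph V)

/-! Fix a spanning tree `T` containing `τ`, root it at a vertex of `τ`, and let `π` be its parent
map. The proof guesses the conditional probability of returning `T` from each configuration
(`value`) and checks that it is a martingale. With Δ_B the Dirichlet Laplacian, the guess at the
head of the loop is 1 / det Δ_{V(H)} if `H ≤ T`, and 0 otherwise.

The guess rests on Cramer's rule, G_B(x,x) = det Δ_{B ∪ x} / det Δ_B (`green_self`). The probability
that a loop erasure follows a given path is a product of such Green functions, so it telescopes to a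
ratio of determinants that depends only on the vertices absorbed. During a walk the guess is
`potential`, in which the futures are sorted by the oldest vertex of the current loop erasure that
is still to be visited.

Harmonicity is `expect_step_value`. Termination (`tendsto_runningProb`) follows from a bound on the
expected running time, and optional stopping then gives the probability 1 / det Δ_{V(τ)}, in which
`T` does not appear. Total mass one identifies this constant. -/

/-- The Laplacian of `G` with Dirichlet boundary conditions on `B`: the rows indexed by `B` are
those of the identity matrix. -/
noncomputable def dirichletLaplacian (B : Set V) : Matrix V V ℝ :=
  Matrix.of fun x => if x ∈ B then Pi.single x 1 else G.lapMatrix ℝ x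

/-- The Green function of the random walk on `G` killed on `B`. -/
noncomputable def green (B : Set V) : Matrix V V ℝ := (dirichletLaplacian G B)⁻¹

variable {G} {B : Set V}

lemma dirichletLaplacian_mulVec_of_mem {x : V} (hx : x ∈ B) (f : V → ℝ) :
    (dirichletLaplacian G B *ᵥ f) x = f x := by
  simp [dirichletLaplacian, Matrix.mulVec, hx]

lemma dirichletLaplacian_mulVec_of_notMem {x : V} (hx : x ∉ B) (f : V → ℝ) :
    (dirichletLaplacian G B *ᵥ f) x = G.degree x * f x - ∑ y ∈ G.neighborFinset x, f y := by
  rw [← SimpleGraph.lapMatrix_mulVec_apply]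
  simp [dirichletLaplacian, Matrix.mulVec, hx]

lemma dirichletLaplacian_univ : dirichletLaplacian G Set.univ = 1 := by
  ext x y
  simp [dirichletLaplacian, Matrix.one_apply, Pi.single_apply, eq_comm]

lemma dirichletLaplacian_insert (x : V) :
    dirichletLaplacian G (insert x B) = (dirichletLaplacian G B).updateRow x (Pi.single x 1) := by
  ext y z
  by_cases h : y = x
  · subst h; simp [dirichletLaplacian]
  · simp [dirichletLaplacian, h, Matrix.updateRow_ne]

/-- The minimum principle. -/
lemma nonneg_of_dirichletLaplacian_mulVec_nonneg (hG : G.Connected) (hB : B.Nonempty) {f : V → ℝ}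
    (h : ∀ x, 0 ≤ (dirichletLaplacian G B *ᵥ f) x) (x : V) : 0 ≤ f x := by
  have := hG.nonempty
  obtain ⟨m, hm⟩ := Finite.exists_min f
  by_contra! hx
  have hneg : f m < 0 := (hm x).trans_lt hx
  -- The set where a negative minimum is attained avoids `B` and is closed under adjacency. By
  -- connectedness it is all of `V`, although `B` is nonempty.
  have key : ∀ a, f a = f m → a ∉ B ∧ ∀ b, G.Adj a b → f b = f m := by
    intro a ha
    have haB : a ∉ B := by
      intro haB
      have := h a
      rw [dirichletLaplacian_mulVec_of_mem haB] at this
      linarith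
    refine ⟨haB, fun b hab => ?_⟩
    have h1 := h a
    rw [dirichletLaplacian_mulVec_of_notMem haB] at h1
    have h2 : ∑ y ∈ G.neighborFinset a, (f y - f m) ≤ 0 := by
      rw [Finset.sum_sub_distrib]
      simp only [Finset.sum_const, SimpleGraph.card_neighborFinset_eq_degree, nsmul_eq_mul]
      rw [ha] at h1
      linarith
    have h3 := (Finset.sum_eq_zero_iff_of_nonneg (fun y _ => sub_nonneg.2 (hm y))).1
      (le_antisymm h2 (Finset.sum_nonneg fun y _ => sub_nonneg.2 (hm y))) b (by simpa using hab)
    linarith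
  obtain ⟨b, hb⟩ := hB
  have hall : ∀ a, f a = f m := by
    intro a
    obtain ⟨w⟩ := hG.preconnected a m
    induction w with
    | nil => rfl
    | cons hab w ih => exact (key _ (ih hm hneg key)).2 _ hab.symm
  exact (key b (hall b)).1 hb

lemma isUnit_dirichletLaplacian (hG : G.Connected) (hB : B.Nonempty) :
    IsUnit (dirichletLaplacian G B) := by
  rw [← Matrix.mulVec_injective_iff_isUnit]
  intro f g hfg
  have hz : dirichletLaplacian G B *ᵥ (f - g) = 0 := by
    rw [Matrix.mulVec_sub]; exact sub_eq_zero.2 hfg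
  have hz' : dirichletLaplacian G B *ᵥ (g - f) = 0 := by
    rw [Matrix.mulVec_sub]; exact sub_eq_zero.2 hfg.symm
  ext x
  have h1 := nonneg_of_dirichletLaplacian_mulVec_nonneg hG hB (f := f - g) (by simp [hz]) x
  have h2 := nonneg_of_dirichletLaplacian_mulVec_nonneg hG hB (f := g - f) (by simp [hz']) x
  simp only [Pi.sub_apply] at h1 h2
  linarith

lemma isUnit_det_dirichletLaplacian (hG : G.Connected) (hB : B.Nonempty) :
    IsUnit (dirichletLaplacian G B).det :=
  (Matrix.isUnit_iff_isUnit_det _).1 (isUnit_dirichletLaplacian hG hB)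

lemma dirichletLaplacian_mulVec_green (hG : G.Connected) (hB : B.Nonempty) (a : V) :
    dirichletLaplacian G B *ᵥ (fun x => green G B x a) = Pi.single a 1 := by
  have h := Matrix.mul_nonsing_inv _ (isUnit_det_dirichletLaplacian hG hB)
  ext x
  have := congrFun (congrFun h x) a
  rw [Matrix.mul_apply', Matrix.one_apply] at this
  rw [Pi.single_apply]
  exact this

lemma green_nonneg (hG : G.Connected) (hB : B.Nonempty) (x a : V) : 0 ≤ green G B x a := by
  refine nonneg_of_dirichletLaplacian_mulVec_nonneg hG hB (f := fun x => green G B x a) ?_ x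
  intro y
  rw [dirichletLaplacian_mulVec_green hG hB, Pi.single_apply]
  split_ifs <;> norm_num

lemma green_of_mem (hG : G.Connected) {x : V} (hx : x ∈ B) (a : V) :
    green G B x a = if x = a then 1 else 0 := by
  have := congrFun (dirichletLaplacian_mulVec_green hG ⟨x, hx⟩ a) x
  rwa [dirichletLaplacian_mulVec_of_mem hx, Pi.single_apply] at this

lemma degree_mul_green_sub_sum (hG : G.Connected) (hB : B.Nonempty) {x : V} (hx : x ∉ B) (a : V) :
    G.degree x * green G B x a - ∑ y ∈ G.neighborFinset x, green G B y a =
      if x = a then 1 else 0 := by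
  have := congrFun (dirichletLaplacian_mulVec_green hG hB a) x
  rwa [dirichletLaplacian_mulVec_of_notMem hx, Pi.single_apply] at this

/-- Cramer's rule: the diagonal cofactor at `x` is the determinant with row `x` replaced by a unit
vector, which amounts to adding `x` to the boundary. -/
lemma green_self (x : V) :
    green G B x x =
      (dirichletLaplacian G (insert x B)).det / (dirichletLaplacian G B).det := by
  rw [green, Matrix.inv_def, Matrix.smul_apply, Matrix.adjugate_apply, dirichletLaplacian_insert,
    Ring.inverse_eq_inv', smul_eq_mul]
  field_simp

/-- Induction on the size of the complement of `B`, starting from the identity matrix: the ratio of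
consecutive determinants is a diagonal Green function, hence nonnegative. -/
lemma det_dirichletLaplacian_pos (hG : G.Connected) (hB : B.Nonempty) :
    0 < (dirichletLaplacian G B).det := by
  induction hn : (Bᶜ : Set V).ncard generalizing B with
  | zero =>
    have : B = Set.univ := by
      simpa [Set.ncard_eq_zero (Set.toFinite _)] using hn
    subst this
    simp [dirichletLaplacian_univ]
  | succ n ih =>
    obtain ⟨x, hx⟩ : (Bᶜ : Set V).Nonempty := Set.nonempty_of_ncard_ne_zero (by omega)
    have h1 : 0 < (dirichletLaplacian G (insert x B)).det := by
      refine ih (Set.insert_nonempty _ _) ?_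
      have : (insert x B)ᶜ = Bᶜ \ {x} := by ext; simp [not_or, and_comm]
      rw [this, Set.ncard_sdiff_singleton_of_mem hx, hn]
      rfl
    have h2 := green_nonneg hG hB x x
    rw [green_self] at h2
    have h3 := (isUnit_det_dirichletLaplacian hG hB).ne_zero
    by_contra! hneg
    exact absurd h2 (not_le.2 (div_neg_of_pos_of_neg h1 (lt_of_le_of_ne hneg h3)))

lemma green_self_div (hG : G.Connected) (x : V) :
    green G B x x / (dirichletLaplacian G (insert x B)).det =
      (dirichletLaplacian G B).det⁻¹ := by
  have := (det_dirichletLaplacian_pos hG (Set.insert_nonempty x B)).ne'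
  rw [green_self]
  field_simp

/-- The expected hitting time of `B`. -/
lemma exists_hittingTime (hG : G.Connected) (hB : B.Nonempty) :
    ∃ g : V → ℝ, (∀ x, 0 ≤ g x) ∧ (∀ x ∈ B, g x = 0) ∧
      ∀ x ∉ B, G.degree x * g x = G.degree x + ∑ y ∈ G.neighborFinset x, g y := by
  obtain ⟨g, hg⟩ := Matrix.mulVec_surjective_iff_isUnit.2 (isUnit_dirichletLaplacian hG hB)
    (fun x => if x ∈ B then 0 else (G.degree x : ℝ))
  refine ⟨g, nonneg_of_dirichletLaplacian_mulVec_nonneg hG hB ?_, fun x hx => ?_, fun x hx => ?_⟩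
  · intro x
    simp only [hg]
    split_ifs <;> positivity
  · have := congrFun hg x
    simpa [dirichletLaplacian_mulVec_of_mem hx, hx] using this
  · have := congrFun hg x
    rw [dirichletLaplacian_mulVec_of_notMem hx, if_neg hx] at this
    linarith

end Green

/-! ### Expectations with respect to a `PMF`. -/

section Expectation

variable {α β : Type*}

/-- The expectation of a nonnegative function. -/
noncomputable def expect (μ : PMF α) (f : α → ℝ≥0∞) : ℝ≥0∞ := ∑' a, μ a * f a

lemma expect_pure (a : α) (f : α → ℝ≥0∞) : expect (PMF.pure a) f = f a := by
  classical
  rw [expect, tsum_eq_single a]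
  · simp
  · intro b hb
    simp [PMF.pure_apply, hb]

lemma expect_bind (μ : PMF α) (k : α → PMF β) (f : β → ℝ≥0∞) :
    expect (μ.bind k) f = expect μ fun a => expect (k a) f := by
  simp only [expect, PMF.bind_apply, ← ENNReal.tsum_mul_right, ← ENNReal.tsum_mul_left]
  rw [ENNReal.tsum_comm]
  simp only [mul_assoc]

lemma expect_map (μ : PMF α) (g : α → β) (f : β → ℝ≥0∞) :
    expect (μ.map g) f = expect μ fun a => f (g a) := by
  rw [PMF.map, expect_bind]
  simp [expect_pure]

lemma expect_add (μ : PMF α) (f g : α → ℝ≥0∞) :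
    (expect μ fun a => f a + g a) = expect μ f + expect μ g := by
  simp only [expect, mul_add, ENNReal.tsum_add]

lemma expect_mono {μ : PMF α} {f g : α → ℝ≥0∞} (h : ∀ a ∈ μ.support, f a ≤ g a) :
    expect μ f ≤ expect μ g := by
  refine ENNReal.tsum_le_tsum fun a => ?_
  by_cases ha : μ a = 0
  · simp [ha]
  · exact mul_le_mul_right (h a ((PMF.mem_support_iff _ _).2 ha)) _

lemma expect_congr {μ : PMF α} {f g : α → ℝ≥0∞} (h : ∀ a ∈ μ.support, f a = g a) :
    expect μ f = expect μ g :=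
  le_antisymm (expect_mono fun a ha => (h a ha).le) (expect_mono fun a ha => (h a ha).ge)

lemma expect_const (μ : PMF α) (c : ℝ≥0∞) : (expect μ fun _ => c) = c := by
  rw [expect, ENNReal.tsum_mul_right, μ.tsum_coe, one_mul]

lemma expect_const_mul (μ : PMF α) (c : ℝ≥0∞) (f : α → ℝ≥0∞) :
    (expect μ fun a => c * f a) = c * expect μ f := by
  simp only [expect, ← ENNReal.tsum_mul_left]
  exact tsum_congr fun a => by ring

lemma expect_uniformOfFintype_ofReal [Fintype α] [Nonempty α] {f : α → ℝ} (hf : ∀ a, 0 ≤ f a) :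
    (expect (PMF.uniformOfFintype α) fun a => ENNReal.ofReal (f a)) =
      ENNReal.ofReal ((∑ a, f a) / Fintype.card α) := by
  have hc : (0 : ℝ) < Fintype.card α := by exact_mod_cast Fintype.card_pos
  rw [ENNReal.ofReal_div_of_pos hc, ENNReal.ofReal_sum_of_nonneg fun a _ => hf a, expect,
    tsum_fintype]
  simp only [PMF.uniformOfFintype_apply, ENNReal.ofReal_natCast]
  rw [← Finset.mul_sum, mul_comm, ENNReal.div_eq_inv_mul, mul_comm]

end Expectation

/-! ### Martingale arguments for the law of the algorithm. -/

section Law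

open Classical Filter Topology

variable [Fintype V] {G : SimpleGraph V} {τ : G.Subgraph} {I : State G → Prop}

/-- The predicate that the algorithm has not stopped yet. -/
def State.Running : State G → Prop
  | .returned _ => False
  | _ => True

lemma forall_law_of_step (h0 : I (.loop τ)) (hs : ∀ s, I s → ∀ t ∈ (step G s).support, I t) (n : ℕ) :
    ∀ s ∈ (law G τ n).support, I s := by
  induction n with
  | zero => simpa [law] using h0
  | succ n ih =>
    intro t ht
    rw [law, PMF.mem_support_bind_iff] at ht
    obtain ⟨s, hs', hst⟩ := ht
    exact hs s (ih s hs') t hst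

lemma expect_law_of_harmonic (hI : ∀ n, ∀ s ∈ (law G τ n).support, I s) {f : State G → ℝ≥0∞}
    (hf : ∀ s, I s → expect (step G s) f = f s) (n : ℕ) :
    expect (law G τ n) f = f (.loop τ) := by
  induction n with
  | zero => exact expect_pure _ _
  | succ n ih =>
    rw [law, expect_bind, ← ih]
    exact expect_congr fun s hs => hf s (hI n s hs)

/-- The probability that the algorithm is still running after `n` steps. -/
noncomputable def runningProb (G : SimpleGraph V) (τ : G.Subgraph) (n : ℕ) : ℝ≥0∞ :=
  expect (law G τ n) fun s => if s.Running then 1 else 0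

/-- Foster–Lyapunov argument: `f` loses at least one on average per running step, so the running
probabilities have a sum of at most `f (.loop τ)`. -/
lemma tendsto_runningProb_of_drift (hI : ∀ n, ∀ s ∈ (law G τ n).support, I s)
    {f : State G → ℝ≥0∞} (hfin : f (.loop τ) ≠ ∞)
    (hf : ∀ s, I s → (expect (step G s) f + if s.Running then 1 else 0) ≤ f s) :
    Tendsto (runningProb G τ) atTop (𝓝 0) := by
  have key : ∀ n, ∑ i ∈ Finset.range n, runningProb G τ i + expect (law G τ n) f
      ≤ f (.loop τ) := by
    intro n
    induction n with
    | zero => simp [law, expect_pure]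
    | succ n ih =>
      refine le_trans ?_ ih
      rw [Finset.sum_range_succ, add_assoc]
      refine add_le_add le_rfl ?_
      rw [law, expect_bind, runningProb, add_comm, ← expect_add]
      exact expect_mono fun s hs => hf s (hI n s hs)
  refine ENNReal.tendsto_atTop_zero_of_tsum_ne_top (ne_top_of_le_ne_top hfin ?_)
  rw [ENNReal.tsum_eq_iSup_nat]
  exact iSup_le fun n => le_self_add.trans (key n)

lemma law_returned_mono (T : G.Subgraph) : Monotone fun n => law G τ n (.returned T) := by
  refine monotone_nat_of_le_succ fun n => ?_
  rw [law, PMF.bind_apply]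
  refine le_trans ?_ (ENNReal.le_tsum (State.returned T))
  simp [step]

lemma sum_law_returned_add_runningProb (n : ℕ) :
    ∑ T : G.Subgraph, law G τ n (.returned T) + runningProb G τ n = 1 := by
  have h : ∀ s : State G, (1 : ℝ≥0∞) =
      (∑ T : G.Subgraph, if s = .returned T then 1 else 0) + if s.Running then 1 else 0 := by
    intro s
    cases s <;> simp [State.Running]
  have h2 : ∀ T : G.Subgraph, law G τ n (.returned T) =
      expect (law G τ n) fun s => if s = .returned T then 1 else 0 := by
    intro T
    rw [expect, tsum_eq_single (State.returned T)]
    · simp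
    · intro b hb
      simp [hb]
  rw [← expect_const (law G τ n) 1, expect_congr fun s _ => h s, expect_add, runningProb]
  congr 1
  simp only [h2, expect, Finset.mul_sum]
  exact (Summable.tsum_finsetSum fun _ _ => ENNReal.summable).symm

/-- If the algorithm terminates almost surely then its output has total mass one. -/
lemma tsum_returnProb_eq_one (h : Tendsto (runningProb G τ) atTop (𝓝 0)) :
    ∑' T : G.Subgraph, returnProb G τ T = 1 := by
  rw [tsum_fintype]
  simp only [returnProb]
  rw [ENNReal.finsetSum_iSup_of_monotone law_returned_mono]
  refine le_antisymm (iSup_le fun n => ?_) ?_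
  · rw [← sum_law_returned_add_runningProb (G := G) (τ := τ) n]
    exact le_self_add
  · have h1 := (tendsto_const_nhds
      (x := ⨆ n, ∑ T : G.Subgraph, law G τ n (.returned T))).add h
    rw [add_zero] at h1
    refine ge_of_tendsto' h1 fun n => ?_
    rw [← sum_law_returned_add_runningProb (G := G) (τ := τ) n]
    exact add_le_add (le_iSup (fun n => ∑ T : G.Subgraph, law G τ n (.returned T)) n) le_rfl

/-- Optional stopping for a bounded harmonic function. -/
lemma returnProb_eq_of_harmonic (h : Tendsto (runningProb G τ) atTop (𝓝 0))
    (hI : ∀ n, ∀ s ∈ (law G τ n).support, I s) {f : State G → ℝ≥0∞}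
    (hf : ∀ s, I s → expect (step G s) f = f s) {K : ℝ≥0∞} (hK : K ≠ ∞)
    (hb : ∀ s, I s → f s ≤ K) {T : G.Subgraph}
    (hT : ∀ H, f (.returned H) = if H = T then 1 else 0) :
    returnProb G τ T = f (.loop τ) := by
  have hle : ∀ n, law G τ n (.returned T) ≤ f (.loop τ) := by
    intro n
    rw [← expect_law_of_harmonic hI hf n]
    refine le_trans ?_ (ENNReal.le_tsum (State.returned T))
    simp [hT]
  refine le_antisymm (iSup_le hle) ?_
  -- On stopped configurations `f` is the indicator of returning `T`; the running ones contribute at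
  -- most `K` times a probability that tends to 0.
  have h1 := (tendsto_const_nhds (x := returnProb G τ T)).add
    (ENNReal.Tendsto.const_mul h (Or.inr hK) (a := K))
  rw [mul_zero, add_zero] at h1
  refine ge_of_tendsto' h1 fun n => ?_
  rw [← expect_law_of_harmonic hI hf n]
  calc expect (law G τ n) f
      ≤ expect (law G τ n) fun s =>
          (if s = .returned T then 1 else 0) + K * if s.Running then 1 else 0 := by
        refine expect_mono fun s hs => ?_
        have hbs := hb s (hI n s hs)
        cases s with
        | returned H => simp [hT, State.Running]
        | loop H => simpa [State.Running] using hbs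
        | walking H w => simpa [State.Running] using hbs
    _ = law G τ n (.returned T) + K * runningProb G τ n := by
        rw [expect_add, expect_const_mul, runningProb]
        congr 1
        rw [expect, tsum_eq_single (State.returned T)]
        · simp
        · intro b hb
          simp [hb]
    _ ≤ returnProb G τ T + K * runningProb G τ n :=
        add_le_add (le_iSup (fun n => law G τ n (.returned T)) n) le_rfl

end Law

/-! ### Rooted trees, parent maps and paths attached to a subtree. -/

section Trees

open SimpleGraph

/-- The parent map and the height function of a tree rooted at `r`. -/
lemma exists_parent {T : SimpleGraph V} (hT : T.IsTree) (r : V) :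
    ∃ (π : V → V) (ht : V → ℕ),
      (∀ x, x ≠ r → T.Adj x (π x) ∧ ht (π x) < ht x) ∧
      (∀ a b, T.Adj a b → (b ≠ r ∧ π b = a) ∨ (a ≠ r ∧ π a = b)) ∧
      ∀ x (p : T.Walk x r), p.IsPath → p.snd = π x := by
  choose P hP huniq using fun x => hT.existsUnique_path x r
  refine ⟨fun x => (P x).snd, fun x => (P x).length, fun x hx => ?_, fun a b hab => ?_,
    fun x p hp => by rw [huniq x p hp]⟩
  · have hnil : ¬ (P x).Nil := Walk.not_nil_of_ne hx
    refine ⟨(P x).adj_snd hnil, ?_⟩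
    have h1 : (P x).tail = P (P x).snd := huniq _ _ (hP x).tail
    have h2 := (P x).length_tail_add_one hnil
    simp only
    rw [← h1]
    omega
  -- If `b` is on the path from `a` to the root, acyclicity makes it the second vertex; otherwise
  -- prepending `b` gives the path from `b`.
  · by_cases hb : b ∈ (P a).support
    · right
      have h := hT.isAcyclic.eq_snd_of_adj_start (hP a) hab hb
      refine ⟨?_, h.symm⟩
      rintro rfl
      have : P a = Walk.nil := (huniq a _ Walk.IsPath.nil).symm
      rw [this] at hb
      simp only [Walk.support_nil, List.mem_singleton] at hb
      exact hab.ne hb.symm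
    · left
      have h : Walk.cons hab.symm (P a) = P b := huniq b _ ((hP a).cons hb)
      refine ⟨?_, by simp [← h]⟩
      rintro rfl
      exact hb (Walk.end_mem_support _)

variable {G : SimpleGraph V}

lemma isTree_spanningCoe {T : G.Subgraph} (hs : T.IsSpanning) (hT : IsSubtree T) :
    T.spanningCoe.IsTree :=
  (T.spanningCoeEquivCoeOfSpanning hs).isTree_iff.2 hT

/-- A connected subgraph of a rooted tree that contains the root contains, with each vertex, the
edge to its parent. -/
lemma adj_parent {T H : G.Subgraph} (hH : H.Connected) (hHT : H ≤ T) {r x : V} {y : V}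
    (hr : r ∈ H.verts) (hx : x ∈ H.verts) (hxr : x ≠ r)
    (hy : ∀ p : T.spanningCoe.Walk x r, p.IsPath → p.snd = y) : H.Adj x y := by
  obtain ⟨p, hp⟩ := (hH.preconnected.coe ⟨x, hx⟩ ⟨r, hr⟩).exists_isPath
  let f : H.coe →g T.spanningCoe := ⟨Subtype.val, fun h => hHT.2 h⟩
  have h := hy (p.map f) (hp.map Subtype.val_injective)
  have hnil : ¬ p.Nil := Walk.not_nil_of_ne fun h => hxr (congrArg Subtype.val h)
  have h2 : H.Adj x (p.snd : V) := p.adj_snd hnil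
  rw [← h]
  rwa [Walk.snd, Walk.getVert_map]

/-- Every edge of `T` points from child to parent. The condition on `x` forces the first edge to
point towards `x`, and since a path does not revisit `x`, the next edges inherit this orientation.
-/
lemma isChain_parent_of_le {T : G.Subgraph} {π : V → V} {r : V}
    (hπ : ∀ a b, T.Adj a b → (b ≠ r ∧ π b = a) ∨ (a ≠ r ∧ π a = b))
    {x v : V} (p : G.Walk x v) (hp : p.IsPath) (hle : p.toSubgraph ≤ T)
    (hx : x = r ∨ π x ∉ p.support.tail) :
    p.support.IsChain (fun a b => π b = a) := by
  induction p with
  | nil => simp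
  | @cons x y v h p ih =>
    rw [Walk.toSubgraph, sup_le_iff, subgraphOfAdj_le_iff] at hle
    rw [Walk.cons_isPath_iff] at hp
    have hy : π y = x := by
      rcases hπ x y hle.1 with h1 | h1
      · exact h1.2
      · rcases hx with rfl | hx
        · exact absurd rfl h1.1
        · simp [h1.2] at hx
    have := ih hp.1 hle.2 (Or.inr fun hmem => hp.2 (hy ▸ List.mem_of_mem_tail hmem))
    rw [Walk.support_cons]
    rw [← Walk.cons_tail_support p] at this ⊢
    exact List.isChain_cons_cons.2 ⟨hy, this⟩

lemma toSubgraph_le_of_isChain_parent {T : G.Subgraph} (hs : T.IsSpanning) {π : V → V} {r : V}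
    (hπ : ∀ x, x ≠ r → T.Adj x (π x)) {x v : V} (p : G.Walk x v) (hr : r ∉ p.support.tail)
    (hc : p.support.IsChain (fun a b => π b = a)) : p.toSubgraph ≤ T := by
  induction p with
  | nil => simpa using hs _
  | @cons x y v h p ih =>
    rw [Walk.support_cons] at hc hr
    rw [List.tail_cons] at hr
    rw [← Walk.cons_tail_support p] at hc
    rw [List.isChain_cons_cons, Walk.cons_tail_support] at hc
    rw [Walk.toSubgraph, sup_le_iff, subgraphOfAdj_le_iff]
    refine ⟨?_, ih (fun h => hr (List.mem_of_mem_tail h)) hc.2⟩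
    have := hπ y (by rintro rfl; exact hr (Walk.start_mem_support _))
    rw [hc.1] at this
    exact this.symm

lemma loopErasure_isPath {x v : V} (w : G.Walk x v) : (loopErasure w).IsPath := by
  classical
  unfold loopErasure
  exact w.bypass_isPath

lemma notMem_of_mem_tail_support_loopErasure {B : Set V} {x v : V} {w : G.Walk x v}
    (hw : ∀ y ∈ w.support.tail, y ∉ B) : ∀ y ∈ (loopErasure w).support.tail, y ∉ B := by
  classical
  intro y hy
  have h1 : y ∈ w.support := by
    unfold loopErasure at hy
    exact w.support_bypass_subset_support (List.mem_of_mem_tail hy)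
  rw [SimpleGraph.Walk.mem_support_iff] at h1
  rcases h1 with rfl | h1
  · have := (loopErasure_isPath w).support_nodup
    rw [← SimpleGraph.Walk.cons_tail_support, List.nodup_cons] at this
    exact absurd hy this.1
  · exact hw y h1

/-- Heights increase along the list, so the parent of its head, being lower still, cannot lie on it.
-/
lemma height_le_of_isChain {π : V → V} {ht : V → ℕ} {r : V} (hht : ∀ x, x ≠ r → ht (π x) < ht x)
    {x : V} {l : List V} (hr : r ∉ l) (hc : (x :: l).IsChain (fun a b => π b = a)) :
    ∀ y ∈ x :: l, ht x ≤ ht y := by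
  induction l generalizing x with
  | nil => simp
  | cons a l ih =>
    rw [List.isChain_cons_cons] at hc
    rw [List.mem_cons, not_or] at hr
    have h1 := hht a (Ne.symm hr.1)
    rw [hc.1] at h1
    intro y hy
    rcases List.mem_cons.1 hy with rfl | hy
    · exact le_rfl
    · exact h1.le.trans (ih hr.2 hc.2 y hy)

lemma exists_adj_of_ne (hG : G.Connected) {x r : V} (h : x ≠ r) : ∃ y, G.Adj x y := by
  obtain ⟨w⟩ := hG.preconnected x r
  cases w with
  | nil => exact absurd rfl h
  | cons h _ => exact ⟨_, h⟩

variable [Fintype V]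

lemma isSubtree_iff {H : G.Subgraph} :
    IsSubtree H ↔ H.Connected ∧ H.edgeSet.ncard + 1 = H.verts.ncard := by
  rw [IsSubtree, isTree_iff_connected_and_card, Subgraph.connected_iff', Nat.card_coe_set_eq,
    Nat.card_coe_set_eq, ← Subgraph.image_coe_edgeSet_coe,
    Set.ncard_image_of_injective _ (Sym2.map.injective Subtype.val_injective)]

/-- Counting: the path brings exactly `p.length` new vertices and at most `p.length` new edges,
while connectedness gives the opposite inequality. -/
lemma isSubtree_sup_toSubgraph {H : G.Subgraph} (hH : IsSubtree H) {x v : V} {p : G.Walk x v}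
    (hp : p.IsPath) (hx : x ∈ H.verts) (hd : ∀ y ∈ p.support.tail, y ∉ H.verts) :
    IsSubtree (H ⊔ p.toSubgraph) := by
  classical
  have hcon : (H ⊔ p.toSubgraph).Connected :=
    Subgraph.connected_sup (isSubtree_iff.1 hH).1.preconnected
      p.toSubgraph_connected.preconnected ⟨x, hx, p.start_mem_verts_toSubgraph⟩
  refine isSubtree_iff.2 ⟨hcon, le_antisymm ?_ ?_⟩
  · have h1 : (H ⊔ p.toSubgraph).edgeSet.ncard ≤ H.edgeSet.ncard + p.length := by
      rw [Subgraph.edgeSet_sup]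
      refine (Set.ncard_union_le _ _).trans (add_le_add le_rfl ?_)
      have : p.toSubgraph.edgeSet = (p.edges.toFinset : Set (Sym2 V)) := by
        ext e; simp
      rw [this, Set.ncard_coe_finset]
      exact (List.toFinset_card_le _).trans p.length_edges.le
    have h2 : (H ⊔ p.toSubgraph).verts.ncard = H.verts.ncard + p.length := by
      have : (H ⊔ p.toSubgraph).verts =
          H.verts ∪ (p.support.tail.toFinset : Set V) := by
        ext y
        rw [Subgraph.verts_sup, Set.mem_union, Set.mem_union, Walk.mem_verts_toSubgraph,
          Walk.mem_support_iff]
        simp only [List.coe_toFinset, Set.mem_ofPred_eq]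
        constructor
        · rintro (h | rfl | h)
          exacts [Or.inl h, Or.inl hx, Or.inr h]
        · tauto
      rw [this, Set.ncard_union_eq, Set.ncard_coe_finset,
        List.toFinset_card_of_nodup hp.support_nodup.tail]
      · simp
      · rw [Set.disjoint_right]
        intro y hy
        exact hd y (by simpa using hy)
    have h3 := (isSubtree_iff.1 hH).2
    omega
  · have h := (Subgraph.connected_iff'.1 hcon).card_vert_le_card_edgeSet_add_one
    rwa [Nat.card_coe_set_eq, Nat.card_coe_set_eq,
      ← Set.ncard_image_of_injective _ (Sym2.map.injective Subtype.val_injective),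
      Subgraph.image_coe_edgeSet_coe] at h

lemma eq_of_le_of_isSubtree {H T : G.Subgraph} (hH : IsSubtree H) (hT : IsSubtree T)
    (hHs : H.IsSpanning) (hTs : T.IsSpanning) (hle : H ≤ T) : H = T := by
  have hv : H.verts = T.verts := by
    rw [Subgraph.isSpanning_iff.1 hHs, Subgraph.isSpanning_iff.1 hTs]
  have he : H.edgeSet = T.edgeSet := by
    refine Set.eq_of_subset_of_ncard_le (Subgraph.edgeSet_mono hle) ?_ (Set.toFinite _)
    have h1 := (isSubtree_iff.1 hH).2
    have h2 := (isSubtree_iff.1 hT).2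
    rw [hv] at h1
    omega
  refine Subgraph.ext hv ?_
  ext a b
  rw [← Subgraph.mem_edgeSet, he, Subgraph.mem_edgeSet]

end Trees

/-! ### The potential of a partial loop erasure and its harmonicity. -/

section Potential

open Classical

variable [Fintype V] (G : SimpleGraph V) (π : V → V) (B : Set V)

/-- Let a random walk from `x` be stopped on `B`, and let `l` be the current loop erasure, listed
backwards. Then `potential G π B l x` is the probability that the final loop erasure follows the
parent map `π`, divided by the Dirichlet determinant of the domain that is left. The summand of a
suffix `a :: l'` of `l` accounts for the walks that return to `a` before they hit `B` or `l'`. -/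
noncomputable def potential : List V → V → ℝ
  | [], _ => 0
  | a :: l, x => potential l x +
      if (a :: l).IsChain (fun a b => π b = a) then
        green G (B ∪ {y | y ∈ l}) x a / (dirichletLaplacian G (insert a (B ∪ {y | y ∈ l}))).det
      else 0

variable {G π B}

lemma potential_nonneg (hG : G.Connected) (hB : B.Nonempty) (l : List V) (x : V) :
    0 ≤ potential G π B l x := by
  induction l with
  | nil => simp [potential]
  | cons a l ih =>
    rw [potential]
    refine add_nonneg ih ?_
    split_ifs
    · exact div_nonneg (green_nonneg hG (hB.mono Set.subset_union_left) _ _)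
        (det_dirichletLaplacian_pos hG (Set.insert_nonempty _ _)).le
    · exact le_rfl

lemma potential_eq_zero_of_mem (hG : G.Connected) {l : List V} (hl : ∀ y ∈ l, y ∉ B) {x : V}
    (hx : x ∈ B) : potential G π B l x = 0 := by
  induction l with
  | nil => simp [potential]
  | cons a l ih =>
    have hxa : x ≠ a := by rintro rfl; exact hl x (by simp) hx
    rw [potential, ih fun y hy => hl y (List.mem_cons_of_mem _ hy),
      green_of_mem hG (Or.inl hx), if_neg hxa]
    simp

/-- Erasing a loop at `y` costs nothing: the Green functions of the erased vertices are killed at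
`y`, so they vanish there. -/
lemma potential_append (hG : G.Connected) {l₁ l₂ : List V} {y : V}
    (h : (l₁ ++ y :: l₂).Nodup) :
    potential G π B (l₁ ++ y :: l₂) y = potential G π B (y :: l₂) y := by
  induction l₁ with
  | nil => rfl
  | cons a l ih =>
    rw [List.cons_append, List.nodup_cons] at h
    have hya : y ≠ a := by rintro rfl; exact h.1 (by simp)
    rw [List.cons_append, potential, ih h.2, green_of_mem hG (Or.inr (by simp)), if_neg hya]
    simp

lemma potential_cons_self (hG : G.Connected) (l : List V) (y : V) :
    potential G π B (y :: l) y = potential G π B l y +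
      if (y :: l).IsChain (fun a b => π b = a) then
        (dirichletLaplacian G (B ∪ {z | z ∈ l})).det⁻¹ else 0 := by
  rw [potential, green_self_div hG]

lemma degree_mul_potential_of_notMem (hG : G.Connected) (hB : B.Nonempty) {l : List V} {x : V}
    (hx : x ∉ B) (hxl : x ∉ l) :
    G.degree x * potential G π B l x = ∑ y ∈ G.neighborFinset x, potential G π B l y := by
  induction l with
  | nil => simp [potential]
  | cons a l ih =>
    rw [List.mem_cons, not_or] at hxl
    have h := degree_mul_green_sub_sum (B := B ∪ {y | y ∈ l}) hG
      (hB.mono Set.subset_union_left) (x := x) (by simp [hx, hxl.2]) a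
    rw [if_neg hxl.1, sub_eq_zero] at h
    simp only [potential, mul_add, Finset.sum_add_distrib, ih hxl.2]
    congr 1
    split_ifs
    · rw [← Finset.sum_div, ← h, mul_div_assoc]
    · simp

/-- Only the summand with pole `x` fails to be harmonic at `x`; its defect is the last term. -/
lemma degree_mul_potential_cons (hG : G.Connected) (hB : B.Nonempty) {l : List V} {x : V}
    (hx : x ∉ B) (hxl : x ∉ l) :
    G.degree x * potential G π B (x :: l) x =
      ∑ y ∈ G.neighborFinset x, potential G π B (x :: l) y +
        if (x :: l).IsChain (fun a b => π b = a) then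
          (dirichletLaplacian G (insert x (B ∪ {y | y ∈ l}))).det⁻¹ else 0 := by
  have h := degree_mul_green_sub_sum (B := B ∪ {y | y ∈ l}) hG
    (hB.mono Set.subset_union_left) (x := x) (by simp [hx, hxl]) x
  rw [if_pos rfl, sub_eq_iff_eq_add] at h
  simp only [potential, mul_add, Finset.sum_add_distrib,
    degree_mul_potential_of_notMem hG hB hx hxl, add_assoc]
  congr 1
  split_ifs
  · rw [← Finset.sum_div, mul_div_assoc', h]
    ring
  · simp

/-- If `y` closes a loop, the cut leaves the potential at `y` unchanged. If `y` is new, the one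
additional summand is a diagonal Green function, which collapses to an inverse determinant. -/
lemma potential_loopErasure_cons (hG : G.Connected) {x y v : V} (h : G.Adj y x) (w : G.Walk x v) :
    potential G π B (loopErasure (SimpleGraph.Walk.cons h w)).support y =
      potential G π B (loopErasure w).support y +
        if y ∉ (loopErasure w).support ∧
            (y :: (loopErasure w).support).IsChain (fun a b => π b = a) then
          (dirichletLaplacian G (B ∪ {z | z ∈ (loopErasure w).support})).det⁻¹ else 0 := by
  by_cases hy : y ∈ (loopErasure w).support
  · have h1 : loopErasure (SimpleGraph.Walk.cons h w) = (loopErasure w).dropUntil y hy := by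
      rw [loopErasure, SimpleGraph.Walk.bypass]
      exact dif_pos hy
    have h2 : (loopErasure w).support = ((loopErasure w).takeUntil y hy).support.dropLast ++
        y :: ((loopErasure w).dropUntil y hy).support.tail := by
      rw [SimpleGraph.Walk.cons_tail_support,
        ← SimpleGraph.Walk.support_append_eq_support_dropLast_append,
        SimpleGraph.Walk.take_spec]
    have h3 := (loopErasure_isPath w).support_nodup
    rw [h1, if_neg (by tauto), add_zero]
    conv_rhs => rw [h2]
    rw [h2] at h3
    rw [potential_append hG h3, SimpleGraph.Walk.cons_tail_support]
  · have h1 : loopErasure (SimpleGraph.Walk.cons h w) =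
        SimpleGraph.Walk.cons h (loopErasure w) := by
      rw [loopErasure, SimpleGraph.Walk.bypass]
      exact dif_neg hy
    rw [h1, SimpleGraph.Walk.support_cons, potential_cons_self hG]
    simp only [hy, not_false_eq_true, true_and]

/-- One step of the random walk leaves the mean of the potential unchanged. -/
lemma sum_potential_loopErasure_cons (hG : G.Connected) {r : V} (hr : r ∈ B) {ht : V → ℕ}
    (hπ : ∀ x, x ≠ r → G.Adj x (π x)) (hht : ∀ x, x ≠ r → ht (π x) < ht x)
    {x v : V} {w : G.Walk x v} (hx : x ∉ B) (hw : ∀ y ∈ w.support.tail, y ∉ B) :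
    ∑ y ∈ G.neighborFinset x, (potential G π B (loopErasure w).support y +
        if y ∉ (loopErasure w).support ∧
            (y :: (loopErasure w).support).IsChain (fun a b => π b = a) then
          (dirichletLaplacian G (B ∪ {z | z ∈ (loopErasure w).support})).det⁻¹ else 0) =
      G.degree x * potential G π B (loopErasure w).support x := by
  have hnd := (loopErasure_isPath w).support_nodup
  have hB' := notMem_of_mem_tail_support_loopErasure hw
  rw [← SimpleGraph.Walk.cons_tail_support (loopErasure w)] at hnd ⊢
  set l := (loopErasure w).support.tail with hl
  rw [List.nodup_cons] at hnd
  rw [Finset.sum_add_distrib, degree_mul_potential_cons hG ⟨r, hr⟩ hx hnd.1]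
  congr 1
  have hxr : x ≠ r := by rintro rfl; exact hx hr
  have hset : insert x (B ∪ {y | y ∈ l}) = B ∪ {z | z ∈ x :: l} := by
    ext z; simp only [Set.mem_insert_iff, Set.mem_union, Set.mem_ofPred_eq, List.mem_cons]; tauto
  rw [hset]
  -- If the path so far follows `π`, exactly one neighbour extends it correctly, namely `π x`, and
  -- its contribution equals the defect of harmonicity at `x`.
  by_cases hc : (x :: l).IsChain (fun a b => π b = a)
  · have hπx : π x ∉ x :: l := fun hmem =>
      (height_le_of_isChain hht (fun h => hB' r h hr) hc _ hmem).not_gt (hht x hxr)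
    rw [Finset.sum_eq_single (π x), if_pos ⟨hπx, List.isChain_cons_cons.2 ⟨rfl, hc⟩⟩, if_pos hc]
    · intro y _ hy
      rw [if_neg]
      rintro ⟨-, h⟩
      exact hy (List.isChain_cons_cons.1 h).1.symm
    · intro h
      exact absurd ((SimpleGraph.mem_neighborFinset _ _ _).2 (hπ x hxr)) h
  · rw [if_neg hc]
    refine Finset.sum_eq_zero fun y _ => if_neg ?_
    rintro ⟨-, h⟩
    exact hc (List.isChain_cons_cons.1 h).2

end Potential

/-! ### One step of the algorithm and the reachable configurations. -/

section Steps

open Classical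

variable [Fintype V] {G : SimpleGraph V}

lemma step_loop_of_isSpanning {H : G.Subgraph} (h : H.IsSpanning) :
    step G (.loop H) = PMF.pure (.returned H) := by
  rw [step, dif_neg]
  rintro ⟨v, hv⟩
  exact hv (h v)

lemma step_walking_of_mem {H : G.Subgraph} {x v : V} {w : G.Walk x v} (hx : x ∈ H.verts) :
    step G (.walking H w) = PMF.pure (.loop (H ⊔ (loopErasure w).toSubgraph)) := by
  rw [step, if_pos hx]

lemma expect_step_loop_le {H : G.Subgraph} (h : ¬ H.IsSpanning) {f : State G → ℝ≥0∞} {c : ℝ≥0∞}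
    (hf : ∀ v ∉ H.verts, f (.walking H (SimpleGraph.Walk.nil : G.Walk v v)) ≤ c) :
    expect (step G (.loop H)) f ≤ c := by
  have hne : Nonempty {v : V // v ∉ H.verts} := by
    by_contra hne
    exact h fun v => by_contra fun hv => hne ⟨v, hv⟩
  rw [step, dif_pos hne, expect_map]
  exact (expect_mono fun v _ => hf v.1 v.2).trans (expect_const _ _).le

/-- When every starting vertex gives the same value, the law of its choice is irrelevant. -/
lemma expect_step_loop_eq {H : G.Subgraph} (h : ¬ H.IsSpanning) {f : State G → ℝ≥0∞} {c : ℝ≥0∞}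
    (hf : ∀ v ∉ H.verts, f (.walking H (SimpleGraph.Walk.nil : G.Walk v v)) = c) :
    expect (step G (.loop H)) f = c := by
  have hne : Nonempty {v : V // v ∉ H.verts} := by
    by_contra hne
    exact h fun v => by_contra fun hv => hne ⟨v, hv⟩
  rw [step, dif_pos hne, expect_map]
  exact (expect_congr fun v _ => hf v.1 v.2).trans (expect_const _ _)

lemma expect_step_walking {H : G.Subgraph} {x v : V} {w : G.Walk x v} (hx : x ∉ H.verts)
    (hne : ∃ y, G.Adj x y) {f : State G → ℝ} {F : V → ℝ}
    (hF : ∀ y (h : G.Adj x y), f (.walking H (SimpleGraph.Walk.cons h.symm w)) = F y)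
    (hF0 : ∀ y, G.Adj x y → 0 ≤ F y) :
    (expect (step G (.walking H w)) fun s => ENNReal.ofReal (f s)) =
      ENNReal.ofReal ((∑ y ∈ G.neighborFinset x, F y) / G.degree x) := by
  have hne' : Nonempty (G.neighborSet x) := hne.elim fun y hy => ⟨⟨y, hy⟩⟩
  rw [step, if_neg hx, dif_pos hne', expect_map]
  rw [expect_congr (g := fun y : G.neighborSet x => ENNReal.ofReal (F y))
    fun y _ => by rw [hF y.1 y.2]]
  rw [expect_uniformOfFintype_ofReal (f := fun y : G.neighborSet x => F y)
    fun y => hF0 y.1 y.2]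
  congr 2
  · exact (Finset.sum_subtype (G.neighborFinset x) (p := (· ∈ G.neighborSet x))
      (fun y => by simp) F).symm
  · rw [← SimpleGraph.card_neighborSet_eq_degree]

/-- The configurations that Wilson's algorithm can reach. -/
def Reachable (τ : G.Subgraph) : State G → Prop
  | .loop H => τ ≤ H ∧ IsSubtree H
  | .walking (v := v) H w =>
      (τ ≤ H ∧ IsSubtree H) ∧ v ∉ H.verts ∧ ∀ y ∈ w.support.tail, y ∉ H.verts
  | .returned H => (τ ≤ H ∧ IsSubtree H) ∧ H.IsSpanning

lemma Reachable.step {τ : G.Subgraph} {s : State G} (hs : Reachable τ s) :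
    ∀ t ∈ (step G s).support, Reachable τ t := by
  intro t ht
  cases s with
  | returned H =>
    rw [Wilson.step, PMF.support_pure, Set.mem_singleton_iff] at ht
    exact ht ▸ hs
  | loop H =>
    by_cases h : H.IsSpanning
    · rw [step_loop_of_isSpanning h, PMF.support_pure, Set.mem_singleton_iff] at ht
      exact ht ▸ ⟨hs, h⟩
    · rw [Wilson.step] at ht
      split_ifs at ht with hne
      · rw [PMF.mem_support_map_iff] at ht
        obtain ⟨v, -, rfl⟩ := ht
        exact ⟨hs, v.2, by simp⟩
      · exact absurd (fun v => by_contra fun hv => hne ⟨v, hv⟩) h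
  | @walking H x v w =>
    obtain ⟨⟨h1, h2⟩, hv, hw⟩ := hs
    by_cases hx : x ∈ H.verts
    · rw [step_walking_of_mem hx, PMF.support_pure, Set.mem_singleton_iff] at ht
      subst ht
      exact ⟨h1.trans le_sup_left, isSubtree_sup_toSubgraph h2 (loopErasure_isPath w) hx
        (notMem_of_mem_tail_support_loopErasure hw)⟩
    · rw [Wilson.step, if_neg hx] at ht
      split_ifs at ht with hne
      · rw [PMF.mem_support_map_iff] at ht
        obtain ⟨y, -, rfl⟩ := ht
        refine ⟨⟨h1, h2⟩, hv, ?_⟩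
        rw [SimpleGraph.Walk.support_cons, List.tail_cons]
        intro z hz
        rw [SimpleGraph.Walk.mem_support_iff] at hz
        rcases hz with rfl | hz
        exacts [hx, hw z hz]
      · rw [PMF.support_pure, Set.mem_singleton_iff] at ht
        exact ht ▸ ⟨⟨h1, h2⟩, hv, hw⟩

end Steps

/-! ### The martingale, almost sure termination and the return probabilities. -/

section Uniformity

open Classical Filter Topology

variable [Fintype V] {G : SimpleGraph V}

/-- The conditional probability that the algorithm returns `T`, where `π` is the parent map of `T`
for some root. -/
noncomputable def value (π : V → V) (T : G.Subgraph) : State G → ℝ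
  | .loop H => if H ≤ T then (dirichletLaplacian G H.verts).det⁻¹ else 0
  | .walking (x := x) H w =>
      if H ≤ T then potential G π H.verts (loopErasure w).support x else 0
  | .returned H => if H = T then 1 else 0

lemma IsSubtree.nonempty {H : G.Subgraph} (h : IsSubtree H) : H.verts.Nonempty :=
  (isSubtree_iff.1 h).1.nonempty

/-- Trajectories are unbounded, but the value sees them only through their loop erasure and current
position. A loop erasure has no repeated vertex, so finitely many cases remain. -/
lemma exists_value_le (π : V → V) (T : G.Subgraph) : ∃ K : ℝ, ∀ s, value π T s ≤ K := by
  obtain ⟨K₁, hK₁⟩ := (Set.finite_range fun H : G.Subgraph => value π T (.loop H)).bddAbove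
  have hfin : Finite {l : List V // l.length ≤ Fintype.card V} :=
    (List.finite_length_le V (Fintype.card V)).to_subtype
  obtain ⟨K₂, hK₂⟩ := (Set.finite_range
    fun q : G.Subgraph × {l : List V // l.length ≤ Fintype.card V} × V =>
      if q.1 ≤ T then potential G π q.1.verts q.2.1 q.2.2 else 0).bddAbove
  refine ⟨max (max K₁ K₂) 1, fun s => ?_⟩
  cases s with
  | loop H => exact (hK₁ ⟨H, rfl⟩).trans ((le_max_left _ _).trans (le_max_left _ _))
  | @walking H x v w =>
    refine le_trans ?_ ((le_max_right K₁ K₂).trans (le_max_left _ 1))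
    exact hK₂ ⟨(H, ⟨_, (loopErasure_isPath w).support_nodup.length_le_card⟩, x), rfl⟩
  | returned H =>
    refine le_trans ?_ (le_max_right _ _)
    rw [value]
    split_ifs <;> norm_num

lemma expect_step_value (hG : G.Connected) {τ T : G.Subgraph} (hTs : T.IsSpanning)
    (hT : IsSubtree T) {π : V → V} {ht : V → ℕ} {r : V} (hr : r ∈ τ.verts)
    (hπ : ∀ x, x ≠ r → T.Adj x (π x) ∧ ht (π x) < ht x)
    (hadj : ∀ a b, T.Adj a b → (b ≠ r ∧ π b = a) ∨ (a ≠ r ∧ π a = b))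
    (hpath : ∀ x (p : T.spanningCoe.Walk x r), p.IsPath → p.snd = π x)
    {s : State G} (hs : Reachable τ s) :
    (expect (step G s) fun t => ENNReal.ofReal (value π T t)) = ENNReal.ofReal (value π T s) := by
  cases s with
  | returned H => rw [step, expect_pure]
  | loop H =>
    by_cases h : H.IsSpanning
    · rw [step_loop_of_isSpanning h, expect_pure]
      have hiff : H ≤ T ↔ H = T := ⟨eq_of_le_of_isSubtree hs.2 hT h hTs, fun h => h.le⟩
      simp only [value, hiff]
      rw [SimpleGraph.Subgraph.isSpanning_iff.1 h, dirichletLaplacian_univ]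
      simp
    -- The potential of the one-point path at `v` is G(v,v) / det Δ_{H ∪ v} = 1 / det Δ_H, for every
    -- `v`.
    · refine expect_step_loop_eq h fun v _ => ?_
      have hnil : (loopErasure (SimpleGraph.Walk.nil : G.Walk v v)).support = [v] := by
        simp [loopErasure, SimpleGraph.Walk.bypass]
      rw [value, value, hnil, potential_cons_self hG]
      simp [potential]
  | @walking H x v w =>
    obtain ⟨⟨h1, h2⟩, hv, hw⟩ := hs
    have hrH : r ∈ H.verts := h1.1 hr
    have hw' := notMem_of_mem_tail_support_loopErasure hw
    by_cases hx : x ∈ H.verts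
    · rw [step_walking_of_mem hx, expect_pure, value, value, sup_le_iff]
      by_cases hH : H ≤ T
      · have hiff : (loopErasure w).toSubgraph ≤ T ↔
            (loopErasure w).support.IsChain (fun a b => π b = a) := by
          constructor
          · intro hle
            refine isChain_parent_of_le hadj _ (loopErasure_isPath w) hle ?_
            -- Off the root, the parent of `x` lies in the connected subgraph `H`, whereas the rest
            -- of the loop erasure avoids `H`.
            by_cases hxr : x = r
            · exact Or.inl hxr
            · right
              intro hmem
              exact hw' _ hmem (adj_parent (isSubtree_iff.1 h2).1 hH hrH hx hxr
                (hpath x)).snd_mem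
          · exact toSubgraph_le_of_isChain_parent hTs (fun x hx => (hπ x hx).1) _
              fun hmem => hw' _ hmem hrH
        have hset : (H ⊔ (loopErasure w).toSubgraph).verts =
            H.verts ∪ {y | y ∈ (loopErasure w).support.tail} := by
          ext y
          rw [SimpleGraph.Subgraph.verts_sup, Set.mem_union, Set.mem_union,
            SimpleGraph.Walk.mem_verts_toSubgraph, SimpleGraph.Walk.mem_support_iff,
            Set.mem_ofPred_eq]
          constructor
          · rintro (h | rfl | h)
            exacts [Or.inl h, Or.inl hx, Or.inr h]
          · tauto
        rw [if_pos hH, hset, hiff, ← SimpleGraph.Walk.cons_tail_support (loopErasure w),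
          potential_cons_self hG, List.tail_cons, potential_eq_zero_of_mem hG hw' hx, zero_add]
        simp only [hH, true_and]
      · simp [hH]
    · have hxr : x ≠ r := by rintro rfl; exact hx hrH
      have hne := exists_adj_of_ne hG hxr
      have hdeg : (G.degree x : ℝ) ≠ 0 := by
        have := (G.degree_pos_iff_exists_adj x).2 hne
        positivity
      by_cases hH : H ≤ T
      · rw [expect_step_walking hx hne (F := fun y =>
          potential G π H.verts (loopErasure w).support y +
          if y ∉ (loopErasure w).support ∧
              (y :: (loopErasure w).support).IsChain (fun a b => π b = a) then
            (dirichletLaplacian G (H.verts ∪ {z | z ∈ (loopErasure w).support})).det⁻¹ else 0)]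
        · rw [sum_potential_loopErasure_cons hG hrH (fun x hx => (hπ x hx).1.adj_sub)
            (fun x hx => (hπ x hx).2) hx hw, mul_div_cancel_left₀ _ hdeg, value, if_pos hH]
        · intro y h
          rw [value, if_pos hH, potential_loopErasure_cons hG]
        · intro y h
          rw [← potential_loopErasure_cons hG h.symm]
          exact potential_nonneg hG ⟨r, hrH⟩ _ _
      · rw [expect_step_walking hx hne (F := fun _ => 0)]
        · simp [value, hH]
        · intro y h
          rw [value, if_neg hH]
        · simp

/-- A bound for the expected number of steps that are left: `g` is the expected hitting time of
the current tree, and `K` is a bound for all the hitting times. -/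
noncomputable def timeBound (g : Set V → V → ℝ) (K : ℝ) : State G → ℝ
  | .loop H => (K + 2) * (H.vertsᶜ.ncard : ℝ) + 1
  | .walking (x := x) H _ => g H.verts x + (K + 2) * ((H.vertsᶜ.ncard : ℝ) - 1) + 2
  | .returned _ => 0

/-- Each missing vertex is charged `K + 2`: at most `K` expected walk steps, one step to start and
one to stop. The final return costs one more. -/
lemma expect_step_timeBound (hG : G.Connected) {τ : G.Subgraph} {g : Set V → V → ℝ} {K : ℝ}
    (hg0 : ∀ B : Set V, B.Nonempty → ∀ x, 0 ≤ g B x)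
    (hgB : ∀ B : Set V, B.Nonempty → ∀ x ∈ B, g B x = 0)
    (hg : ∀ B : Set V, B.Nonempty → ∀ x ∉ B,
      G.degree x * g B x = G.degree x + ∑ y ∈ G.neighborFinset x, g B y)
    (hK0 : 0 ≤ K) (hK : ∀ B x, g B x ≤ K) {s : State G} (hs : Reachable τ s) :
    ((expect (step G s) fun t => ENNReal.ofReal (timeBound g K t)) +
      if s.Running then 1 else 0) ≤ ENNReal.ofReal (timeBound g K s) := by
  cases s with
  | returned H => simp [step, expect_pure, State.Running]
  | loop H =>
    have hrun : State.Running (.loop H : State G) := trivial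
    rw [if_pos hrun]
    by_cases h : H.IsSpanning
    · rw [step_loop_of_isSpanning h, expect_pure, timeBound, timeBound,
        SimpleGraph.Subgraph.isSpanning_iff.1 h]
      simp
    · have h1 : (expect (step G (.loop H)) fun t => ENNReal.ofReal (timeBound g K t)) ≤
          ENNReal.ofReal ((K + 2) * (H.vertsᶜ.ncard : ℝ)) := by
        refine expect_step_loop_le h fun v _ => ENNReal.ofReal_le_ofReal ?_
        rw [timeBound]
        have := hK H.verts v
        linarith
      refine (add_le_add h1 le_rfl).trans ?_
      rw [timeBound, ENNReal.ofReal_add (by positivity) zero_le_one, ENNReal.ofReal_one]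
  | @walking H x v w =>
    have hrun : State.Running (.walking H w : State G) := trivial
    rw [if_pos hrun]
    obtain ⟨⟨h1, h2⟩, hv, hw⟩ := hs
    have hne := h2.nonempty
    have hc1 : (1 : ℝ) ≤ (H.vertsᶜ.ncard : ℝ) := by
      exact_mod_cast (Set.ncard_pos (Set.toFinite _)).2 ⟨v, hv⟩
    have hc0 : 0 ≤ (K + 2) * ((H.vertsᶜ.ncard : ℝ) - 1) :=
      mul_nonneg (by linarith) (by linarith)
    by_cases hx : x ∈ H.verts
    · rw [step_walking_of_mem hx, expect_pure]
      -- The starting vertex `v` was missing and is absorbed, so every run gains a vertex.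
      have hlt : (H ⊔ (loopErasure w).toSubgraph).vertsᶜ.ncard < H.vertsᶜ.ncard := by
        refine Set.ncard_lt_ncard ?_ (Set.toFinite _)
        exact ⟨fun y hy hyH => hy (Or.inl hyH),
          fun hsub => hsub hv (Or.inr (loopErasure w).end_mem_verts_toSubgraph)⟩
      have hlt' : ((H ⊔ (loopErasure w).toSubgraph).vertsᶜ.ncard : ℝ) ≤
          (H.vertsᶜ.ncard : ℝ) - 1 := by
        rw [le_sub_iff_add_le]
        exact_mod_cast hlt
      rw [← ENNReal.ofReal_one, timeBound, ← ENNReal.ofReal_add (by positivity) zero_le_one,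
        timeBound, hgB _ hne x hx]
      refine ENNReal.ofReal_le_ofReal ?_
      have := mul_le_mul_of_nonneg_left hlt' (by linarith : 0 ≤ K + 2)
      linarith
    · obtain ⟨r, hr⟩ := hne
      have hadj := exists_adj_of_ne hG (show x ≠ r by rintro rfl; exact hx hr)
      have hdeg : (0 : ℝ) < G.degree x := by
        exact_mod_cast (G.degree_pos_iff_exists_adj x).2 hadj
      have hpos : ∀ y, 0 ≤ g H.verts y + (K + 2) * ((H.vertsᶜ.ncard : ℝ) - 1) + 2 := fun y => by
        have := hg0 _ ⟨r, hr⟩ y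
        linarith
      rw [expect_step_walking hx hadj
        (F := fun y => g H.verts y + (K + 2) * ((H.vertsᶜ.ncard : ℝ) - 1) + 2)
        (fun y h => rfl) (fun y _ => hpos y), ← ENNReal.ofReal_one,
        ← ENNReal.ofReal_add (div_nonneg (Finset.sum_nonneg fun y _ => hpos y) hdeg.le)
          zero_le_one, timeBound]
      refine ENNReal.ofReal_le_ofReal (le_of_eq ?_)
      have := hg _ ⟨r, hr⟩ x hx
      simp only [Finset.sum_add_distrib, Finset.sum_const,
        SimpleGraph.card_neighborFinset_eq_degree, nsmul_eq_mul]
      field_simp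
      linarith

lemma forall_reachable {τ : G.Subgraph} (hτ : IsSubtree τ) (n : ℕ) :
    ∀ s ∈ (law G τ n).support, Reachable τ s :=
  forall_law_of_step (I := Reachable τ) ⟨le_rfl, hτ⟩ (fun _ hs => hs.step) n

/-- Wilson's algorithm terminates almost surely. -/
lemma tendsto_runningProb (hG : G.Connected) {τ : G.Subgraph} (hτ : IsSubtree τ) :
    Tendsto (runningProb G τ) atTop (𝓝 0) := by
  have hex : ∀ B : Set V, ∃ g : V → ℝ, B.Nonempty → (∀ x, 0 ≤ g x) ∧ (∀ x ∈ B, g x = 0) ∧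
      ∀ x ∉ B, G.degree x * g x = G.degree x + ∑ y ∈ G.neighborFinset x, g y := by
    intro B
    by_cases hB : B.Nonempty
    · obtain ⟨g, hg⟩ := exists_hittingTime hG hB
      exact ⟨g, fun _ => hg⟩
    · exact ⟨0, fun h => absurd h hB⟩
  choose g hg using hex
  obtain ⟨K, hK⟩ := (Set.finite_range fun q : Set V × V => g q.1 q.2).bddAbove
  exact tendsto_runningProb_of_drift (forall_reachable hτ) ENNReal.ofReal_ne_top
    fun s hs => expect_step_timeBound hG (K := max K 0) (fun B hB => (hg B hB).1)
      (fun B hB => (hg B hB).2.1) (fun B hB => (hg B hB).2.2) (le_max_right _ _)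
      (fun B x => (hK ⟨(B, x), rfl⟩).trans (le_max_left _ _)) hs

/-- Every spanning tree that contains `τ` is returned with the same probability. -/
lemma returnProb_eq_inv_det (hG : G.Connected) {τ T : G.Subgraph} (hτ : IsSubtree τ)
    (hT : T ∈ spanningTreesContaining G τ) :
    returnProb G τ T = ENNReal.ofReal (dirichletLaplacian G τ.verts).det⁻¹ := by
  obtain ⟨hTs, hTt, hle⟩ := hT
  -- With its root in `τ`, the same parent map serves for every later tree `H ≥ τ`.
  obtain ⟨r, hr⟩ := hτ.nonempty
  obtain ⟨π, ht, h1, h2, h3⟩ := exists_parent (isTree_spanningCoe hTs hTt) r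
  obtain ⟨K, hK⟩ := exists_value_le π T
  have := returnProb_eq_of_harmonic (tendsto_runningProb hG hτ) (forall_reachable hτ)
    (f := fun s => ENNReal.ofReal (value π T s)) (K := ENNReal.ofReal K) (T := T)
    (fun s hs => expect_step_value hG hTs hTt hr h1 h2 h3 hs) ENNReal.ofReal_ne_top
    (fun s _ => ENNReal.ofReal_le_ofReal (hK s))
    (fun H => by rw [value]; split_ifs <;> simp)
  rw [this, value, if_pos hle]

lemma returnProb_eq_zero {τ T : G.Subgraph} (hτ : IsSubtree τ)
    (hT : T ∉ spanningTreesContaining G τ) : returnProb G τ T = 0 := by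
  refine ENNReal.iSup_eq_zero.2 fun n => by_contra fun h => hT ?_
  obtain ⟨⟨h1, h2⟩, h3⟩ := forall_reachable hτ n (.returned T) ((PMF.mem_support_iff _ _).2 h)
  exact ⟨h3, h2, h1⟩

end Uniformity

end Wilson

theorem mainTheorem2 {V : Type*} [Fintype V] (G : SimpleGraph V) (hG : G.Connected)
    (τ : G.Subgraph) (hτ : Wilson.IsSubtree τ) (hns : ¬ τ.IsSpanning) :
    -- the algorithm terminates with probability one
    (∑' T : G.Subgraph, Wilson.returnProb G τ T = 1) ∧
    -- its output is uniformly distributed on the spanning trees that contain `τ`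
    (∀ T ∈ Wilson.spanningTreesContaining G τ,
      Wilson.returnProb G τ T = ((Wilson.spanningTreesContaining G τ).ncard : ENNReal)⁻¹) ∧
    (∀ T ∉ Wilson.spanningTreesContaining G τ, Wilson.returnProb G τ T = 0) := by
  classical
  have hsum := Wilson.tsum_returnProb_eq_one (Wilson.tendsto_runningProb hG hτ)
  refine ⟨hsum, fun T hT => ?_, fun T hT => Wilson.returnProb_eq_zero hτ hT⟩
  rw [Wilson.returnProb_eq_inv_det hG hτ hT]
  -- The output law is constant on the admissible trees and zero elsewhere, so total mass one forces
  -- the constant to be the inverse of their number.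
  have h : ∀ T, Wilson.returnProb G τ T = if T ∈ Wilson.spanningTreesContaining G τ then
      ENNReal.ofReal (Wilson.dirichletLaplacian G τ.verts).det⁻¹ else 0 := by
    intro T
    split_ifs with hT
    · exact Wilson.returnProb_eq_inv_det hG hτ hT
    · exact Wilson.returnProb_eq_zero hτ hT
  simp only [h] at hsum
  rw [tsum_fintype, ← Finset.sum_filter, Finset.sum_const, nsmul_eq_mul, mul_comm] at hsum
  rw [Set.ncard_eq_toFinset_card']
  convert ENNReal.eq_inv_of_mul_eq_one_left hsum using 4
  ext; simp
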